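/- For a positive integer $n$ let $t_n$ be the least integer $t\ge 0$ such that some (possibly empty) subset of $\{n+1,\dots,n+t\}$ has the property that the product of its members with $n$ is a perfect square (so $t_n=0$ if and only if $n$ is a square). Let $P^+(n)$ be the largest prime factor of $n$, with $P^+(1)=1$. Let $\rho$ be the Dickman–de Bruijn function: the continuous function on $[0,\infty)$ with $\rho(u)=1$ for $0\le u\le 1$ and $u\rho'(u)=-\rho(u-1)$ for $u>1$. For every fixed $c\in(0,1]$, $$\lim_{x\to\infty}\frac{\#\{1\le n\le x:\ t_n\le n^c\}}{x}=\lim_{x\to\infty}\frac{\#\{1\le n\le x:\ P^+(n)\le n^c\}}{x}=\rho(1/c)>0,$$ where both limits exist and $x$ runs through the real numbers. Consequently, for every fixed $c>0$ a positive proportion of the integers $n$ satisfy $t_n\le n^c$: there is $\delta>0$ (depending on $c$) with $\#\{1\le n\le x: t_n\le n^c\}\ge\delta x$ for all sufficiently large $x$. In particular, there is no constant $c>0$ such that $t_n>n^c$ for all sufficiently large non-square $n$, contrary to what Granville had presumed. -/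

import Mathlib

open Filter Topology

/-- `squareShift n` is `t_n`: the least `t ≥ 0` such that the integers `n + 1, …, n + t` contain a
(possibly empty) subset the product of whose members with `n` is a square.
It is `0` exactly when `n` is a square. -/
noncomputable def squareShift (n : ℕ) : ℕ :=
  sInf {t : ℕ | ∃ S : Finset ℕ, S ⊆ Finset.Ioc n (n + t) ∧ IsSquare (n * ∏ m ∈ S, m)}

/-- The infimum defining `t_n` is over a nonempty set, since `n * (4 * n)` is a square. -/
theorem squareShift_set_nonempty (n : ℕ) :
    {t : ℕ | ∃ S : Finset ℕ, S ⊆ Finset.Ioc n (n + t) ∧ IsSquare (n * ∏ m ∈ S, m)}.Nonempty := by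
  rcases Nat.eq_zero_or_pos n with rfl | hn
  · exact ⟨0, ∅, by simp, by simp⟩
  · refine ⟨3 * n, {4 * n}, ?_, ⟨2 * n, ?_⟩⟩
    · simp only [Finset.singleton_subset_iff, Finset.mem_Ioc]
      omega
    · rw [Finset.prod_singleton]
      ring

/-- `P⁺(n)`, the largest prime factor of a positive integer `n`, with `P⁺(1) = 1`. -/
def largestPrimeFactor (n : ℕ) : ℕ :=
  if n = 1 then 1 else n.primeFactors.sup id

open Classical in
/-- The number of positive integers `n ≤ x` with the property `P`. -/
noncomputable def countUpTo (P : ℕ → Prop) (x : ℝ) : ℕ :=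
  ((Finset.Icc 1 ⌊x⌋₊).filter P).card

/-- Iterates of the integral form of the Dickman delay equation; the `k`-th one agrees with
the Dickman–de Bruijn function on `[0, k + 1]`. -/
noncomputable def dickmanAux : ℕ → ℝ → ℝ
  | 0, _ => 1
  | k + 1, u => 1 - ∫ t in (1 : ℝ)..(max 1 u), dickmanAux k (t - 1) / t

/-- The Dickman–de Bruijn function `ρ`, built by the method of steps: `ρ = 1` on `[0, 1]` and
`ρ u = 1 - ∫ t in 1..u, ρ (t - 1) / t` for `u ≥ 1` (and `ρ = 0` on the negative reals). -/
noncomputable def dickman (u : ℝ) : ℝ :=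
  if u < 0 then 0 else dickmanAux ⌊u⌋₊ u

theorem dickmanAux_continuous (k : ℕ) : Continuous (dickmanAux k) := by
  induction k with
  | zero => exact continuous_const
  | succ k ih =>
    have hg : Continuous fun t : ℝ => dickmanAux k (t - 1) / max 1 t :=
      (ih.comp (continuous_id.sub continuous_const)).div (by fun_prop)
        (fun t => (lt_of_lt_of_le one_pos (le_max_left 1 t)).ne')
    have h : dickmanAux (k + 1) =
        fun u => 1 - ∫ t in (1 : ℝ)..(max 1 u), dickmanAux k (t - 1) / max 1 t := by
      funext u
      rw [dickmanAux]
      congr 1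
      refine intervalIntegral.integral_congr fun t ht => ?_
      rw [Set.uIcc_of_le (le_max_left 1 u)] at ht
      simp only [max_eq_right ht.1]
    rw [h]
    exact continuous_const.sub
      ((intervalIntegral.continuous_primitive (fun a b => hg.intervalIntegrable a b) 1).comp
        (by fun_prop))

theorem dickmanAux_succ_eq (k : ℕ) : ∀ u : ℝ, u ≤ k + 1 →
    dickmanAux (k + 1) u = dickmanAux k u := by
  induction k with
  | zero =>
    intro u hu
    have hu' : u ≤ 1 := by simpa using hu
    simp [dickmanAux, max_eq_left hu']
  | succ k ih =>
    intro u hu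
    rw [dickmanAux.eq_def (k + 1 + 1), dickmanAux.eq_def (k + 1)]
    simp only
    congr 1
    refine intervalIntegral.integral_congr fun t ht => ?_
    rw [Set.uIcc_of_le (le_max_left 1 u)] at ht
    push_cast at hu
    have hk : (0 : ℝ) ≤ k := Nat.cast_nonneg k
    have ht2 : t ≤ k + 1 + 1 := ht.2.trans (max_le (by linarith) hu)
    simp only [ih (t - 1) (by linarith)]

theorem dickman_eq_aux (k : ℕ) (u : ℝ) (h0 : 0 ≤ u) (hu : u ≤ k + 1) :
    dickman u = dickmanAux k u := by
  have key : ∀ j m : ℕ, u ≤ m + 1 → dickmanAux (m + j) u = dickmanAux m u := by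
    intro j m hm
    induction j with
    | zero => rfl
    | succ j ih =>
      rw [← ih, ← add_assoc]
      refine dickmanAux_succ_eq _ _ ?_
      push_cast
      have : (0 : ℝ) ≤ j := Nat.cast_nonneg j
      linarith
  rw [dickman, if_neg (not_lt.mpr h0)]
  have hf : u ≤ (⌊u⌋₊ : ℝ) + 1 := (Nat.lt_floor_add_one u).le
  rcases le_total ⌊u⌋₊ k with h | h
  · obtain ⟨j, rfl⟩ := Nat.exists_eq_add_of_le h
    exact (key j _ hf).symm
  · obtain ⟨j, hj⟩ := Nat.exists_eq_add_of_le h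
    rw [hj]
    exact key j _ hu

/-- `ρ = 1` on `[0, 1]`. -/
theorem dickman_eq_one (u : ℝ) (h0 : 0 ≤ u) (h1 : u ≤ 1) : dickman u = 1 := by
  rw [dickman_eq_aux 0 u h0 (by simpa using h1), dickmanAux]

/-- `ρ` is continuous on `[0, ∞)`. -/
theorem dickman_continuousOn : ContinuousOn dickman (Set.Ici 0) := by
  intro u hu
  have hu0 : (0 : ℝ) ≤ u := hu
  refine ((dickmanAux_continuous (⌊u⌋₊ + 1)).continuousWithinAt).congr_of_eventuallyEq ?_ ?_
  · have hlt : u < (⌊u⌋₊ : ℝ) + 1 := Nat.lt_floor_add_one u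
    filter_upwards [self_mem_nhdsWithin, mem_nhdsWithin_of_mem_nhds (Iio_mem_nhds hlt)] with v h0 h1
    refine dickman_eq_aux _ v h0 ?_
    push_cast
    linarith [Set.mem_Iio.mp h1]
  · refine dickman_eq_aux _ u hu0 ?_
    push_cast
    linarith [Nat.lt_floor_add_one u]

/-- The delay differential equation `u ρ'(u) = -ρ(u - 1)` for `u > 1`. -/
theorem dickman_hasDerivAt (u : ℝ) (hu : 1 < u) :
    HasDerivAt dickman (-dickman (u - 1) / u) u := by
  obtain ⟨k, hk⟩ := exists_nat_gt u
  have hev : dickman =ᶠ[𝓝 u] fun v => 1 - ∫ t in (1 : ℝ)..v, dickmanAux k (t - 1) / max 1 t := by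
    filter_upwards [Ioo_mem_nhds hu hk] with v hv
    rw [dickman_eq_aux (k + 1) v (by linarith [hv.1]) (by push_cast; linarith [hv.2]), dickmanAux,
      max_eq_right hv.1.le]
    congr 1
    refine intervalIntegral.integral_congr fun t ht => ?_
    rw [Set.uIcc_of_le hv.1.le] at ht
    simp only [max_eq_right ht.1]
  have hg : Continuous fun t : ℝ => dickmanAux k (t - 1) / max 1 t :=
    ((dickmanAux_continuous k).comp (continuous_id.sub continuous_const)).div (by fun_prop)
      (fun t => (lt_of_lt_of_le one_pos (le_max_left 1 t)).ne')
  have hd := ((hg.integral_hasStrictDerivAt 1 u).hasDerivAt).const_sub 1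
  refine (hd.congr_of_eventuallyEq hev).congr_deriv ?_
  rw [dickman_eq_aux k (u - 1) (by linarith) (by linarith), max_eq_right hu.le]
  ring

/-! Both counts are compared with Ψ(x, x^{1/u}), the number of x^{1/u}-smooth integers up to x,
which is asymptotic to ρ(u) x.

Upper bound for t_n: if p = P⁺(n) divides n exactly once, a square product needs another multiple of
p beyond n, so t_n ≥ p (`le_squareShift_of_sq_not_dvd`). Hence t_n ≤ n^c forces P⁺(n) ≤ n^c, unless
the square of a large integer divides n, which is rare.

Lower bound: take c' < b < c and cut [1, x] into blocks of length about x^b. Exponent vectors mod 2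
of x^{c'}-smooth numbers live in a space over F₂ of dimension at most x^{c'}, so in each block at
most x^{c'} smooth numbers cannot be completed to a square by larger members of the block
(`card_le_of_forall_not_isSquare`). In total these are O(x^{1-b+c'}) = o(x), and the other smooth n
have t_n < x^b ≤ n^c unless n is small. Then c' → c by continuity of ρ.

Dickman's theorem itself is proved from Mertens' first theorem and Buchstab's identity: any limit
L(u) of Ψ(x, x^{1/u})/x along an ultrafilter satisfies L'(u) = -ρ(u-1)/u and L(1) = 1, hence L = ρ.
-/

/-! ### Mertens' first theorem, from the prime factorization of n! -/

open Finset in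
theorem div_le_factorization_factorial {p n : ℕ} (hp : p.Prime) :
    n / p ≤ (n.factorial).factorization p := by
  rcases lt_or_ge n p with h | h
  · simp [Nat.div_eq_of_lt h]
  · rw [Nat.factorization_factorial hp (Nat.lt_succ_self (Nat.log p n))]
    have h1 : 1 ∈ Ico 1 (Nat.log p n).succ := by
      have := Nat.log_pos hp.one_lt h
      simp only [mem_Ico, le_refl, true_and]
      omega
    simpa using single_le_sum (f := fun i => n / p ^ i) (fun _ _ => Nat.zero_le _) h1

theorem factorization_factorial_mul_le {p n : ℕ} (hp : p.Prime) :
    (p - 1) * (n.factorial).factorization p ≤ n := by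
  have := Fact.mk hp
  rw [Nat.factorization_def _ hp, sub_one_mul_padicValNat_factorial]
  exact Nat.sub_le _ _

theorem log_factorial_eq_sum (n : ℕ) : Real.log n.factorial =
    ∑ p ∈ (Finset.Icc 0 n).filter Nat.Prime, ((n.factorial).factorization p : ℝ) * Real.log p := by
  rw [Real.log_nat_eq_sum_factorization, Finsupp.sum]
  refine Finset.sum_subset (fun p hp => ?_) (fun p _ hp => ?_)
  · rw [Nat.support_factorization, Nat.mem_primeFactors] at hp
    simp [hp.1, (hp.1.dvd_factorial).1 hp.2.1]
  · rw [Finsupp.notMem_support_iff.1 hp]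
    simp

/-- Compare n! ≤ n^n with v_p(n!) ≥ ⌊n/p⌋ > n/p - 1; the loss ∑ log p is at most n log 4 by
Chebyshev. -/
theorem sum_log_div_prime_le {n : ℕ} (hn : n ≠ 0) :
    ∑ p ∈ (Finset.Icc 0 n).filter Nat.Prime, Real.log p / p ≤ Real.log n + Real.log 4 := by
  have hn0 : (0 : ℝ) < n := by positivity
  have h1 : ∑ p ∈ (Finset.Icc 0 n).filter Nat.Prime, ((n : ℝ) / p - 1) * Real.log p ≤
      n * Real.log n := by
    calc _ ≤ Real.log n.factorial := by
          rw [log_factorial_eq_sum]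
          refine Finset.sum_le_sum fun p hp => ?_
          have hp' := (Finset.mem_filter.1 hp).2
          have h2 : (n : ℝ) / p < (n / p : ℕ) + 1 := by
            rw [← Nat.floor_div_eq_div (K := ℝ)]
            exact Nat.lt_floor_add_one _
          have h3 : ((n / p : ℕ) : ℝ) ≤ ((n.factorial).factorization p : ℝ) := by
            exact_mod_cast div_le_factorization_factorial hp'
          exact mul_le_mul_of_nonneg_right (by linarith) (Real.log_natCast_nonneg p)
      _ ≤ Real.log ((n : ℝ) ^ n) := by
          refine Real.log_le_log (by exact_mod_cast n.factorial_pos) ?_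
          exact_mod_cast Nat.factorial_le_pow n
      _ = _ := Real.log_pow _ _
  have h2 : ∑ p ∈ (Finset.Icc 0 n).filter Nat.Prime, Real.log p ≤ Real.log 4 * n := by
    have := Chebyshev.theta_le_log4_mul_x hn0.le
    rwa [Chebyshev.theta_eq_sum_Icc, Nat.floor_natCast] at this
  have h3 : ∑ p ∈ (Finset.Icc 0 n).filter Nat.Prime, ((n : ℝ) / p - 1) * Real.log p =
      n * ∑ p ∈ (Finset.Icc 0 n).filter Nat.Prime, Real.log p / p -
        ∑ p ∈ (Finset.Icc 0 n).filter Nat.Prime, Real.log p := by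
    rw [Finset.mul_sum, ← Finset.sum_sub_distrib]
    exact Finset.sum_congr rfl fun p _ => by ring
  refine le_of_mul_le_mul_left ?_ hn0
  linarith

/-- Trades the n/(p-1) of Legendre's formula for n/p at a summable cost, using log p ≤ 2√p and p - 1
≥ p/2. -/
theorem log_div_sub_one_le {p : ℕ} (hp : 2 ≤ p) :
    Real.log p / ((p : ℝ) - 1) ≤ Real.log p / p + 4 * ((p : ℝ) ^ (3 / 2 : ℝ))⁻¹ := by
  have hp' : (2 : ℝ) ≤ p := by exact_mod_cast hp
  have h0 : (0 : ℝ) < p := by linarith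
  have h1 := Real.log_le_rpow_div h0.le (show (0 : ℝ) < 1 / 2 by norm_num)
  have h2 : Real.log p / ((p : ℝ) - 1) - Real.log p / p = Real.log p / (p * (p - 1)) := by
    have : (p : ℝ) - 1 ≠ 0 := by linarith
    field_simp
    ring
  have h3 : Real.log p / (p * ((p : ℝ) - 1)) ≤ (2 * (p : ℝ) ^ (1 / 2 : ℝ)) / (p * (p / 2)) := by
    gcongr
    · linarith
    · linarith
  have h4 : (p : ℝ) * (p / 2) = (p : ℝ) ^ (1 / 2 : ℝ) * (p : ℝ) ^ (3 / 2 : ℝ) / 2 := by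
    rw [← Real.rpow_add h0]
    norm_num
    ring
  have h5 : (2 * (p : ℝ) ^ (1 / 2 : ℝ)) / (p * (p / 2)) = 4 * ((p : ℝ) ^ (3 / 2 : ℝ))⁻¹ := by
    have := Real.rpow_pos_of_pos h0 (1 / 2)
    have := Real.rpow_pos_of_pos h0 (3 / 2)
    rw [h4]
    field_simp
    norm_num
  linarith

/-- Stirling's n log n - n ≤ log n! is set against v_p(n!) ≤ n/(p-1). -/
theorem exists_le_sum_log_div_prime : ∃ K : ℝ, ∀ n : ℕ, n ≠ 0 →
    Real.log n - K ≤ ∑ p ∈ (Finset.Icc 0 n).filter Nat.Prime, Real.log p / p := by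
  have hs : Summable fun n : ℕ => ((n : ℝ) ^ (3 / 2 : ℝ))⁻¹ :=
    Real.summable_nat_rpow_inv.2 (by norm_num)
  refine ⟨1 + 4 * ∑' n : ℕ, ((n : ℝ) ^ (3 / 2 : ℝ))⁻¹, fun n hn => ?_⟩
  have hn0 : (0 : ℝ) < n := by positivity
  have h1 : Real.log n.factorial ≤
      ∑ p ∈ (Finset.Icc 0 n).filter Nat.Prime,
        n * (Real.log p / p + 4 * ((p : ℝ) ^ (3 / 2 : ℝ))⁻¹) := by
    rw [log_factorial_eq_sum]
    refine Finset.sum_le_sum fun p hp => ?_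
    have hp' := (Finset.mem_filter.1 hp).2
    have hp2 : (0 : ℝ) < (p : ℝ) - 1 := by
      have : (2 : ℝ) ≤ p := by exact_mod_cast hp'.two_le
      linarith
    have h2 : ((p : ℝ) - 1) * (n.factorial).factorization p ≤ n := by
      have := factorization_factorial_mul_le (n := n) hp'
      have h : (((p - 1 : ℕ) : ℝ)) * (n.factorial).factorization p ≤ n := by exact_mod_cast this
      rwa [Nat.cast_sub hp'.one_le, Nat.cast_one] at h
    calc ((n.factorial).factorization p : ℝ) * Real.log p
        ≤ (n / ((p : ℝ) - 1)) * Real.log p := by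
          refine mul_le_mul_of_nonneg_right ?_ (Real.log_natCast_nonneg p)
          rw [le_div_iff₀ hp2]
          linarith
      _ = n * (Real.log p / ((p : ℝ) - 1)) := by ring
      _ ≤ _ := mul_le_mul_of_nonneg_left (log_div_sub_one_le hp'.two_le) hn0.le
  have h2 : (n : ℝ) * Real.log n - n ≤ Real.log n.factorial := by
    have h := Stirling.le_log_factorial_stirling hn
    have h3 := Real.log_natCast_nonneg n
    have h4 : 0 ≤ Real.log (2 * Real.pi) :=
      Real.log_nonneg (by nlinarith [Real.pi_gt_three])
    linarith
  rw [← Finset.mul_sum, Finset.sum_add_distrib, ← Finset.mul_sum] at h1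
  have h3 : ∑ p ∈ (Finset.Icc 0 n).filter Nat.Prime, ((p : ℝ) ^ (3 / 2 : ℝ))⁻¹ ≤
      ∑' n : ℕ, ((n : ℝ) ^ (3 / 2 : ℝ))⁻¹ :=
    hs.sum_le_tsum _ (fun i _ => by positivity)
  refine le_of_mul_le_mul_left ?_ hn0
  nlinarith

/-- The primes in `(y, z]`. -/
noncomputable def primesIoc (y z : ℝ) : Finset ℕ :=
  (Finset.Ioc ⌊y⌋₊ ⌊z⌋₊).filter Nat.Prime

theorem mem_primesIoc {y z : ℝ} (hy : 0 ≤ y) {p : ℕ} :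
    p ∈ primesIoc y z ↔ p.Prime ∧ y < p ∧ (p : ℝ) ≤ z := by
  rw [primesIoc, Finset.mem_filter, Finset.mem_Ioc]
  constructor
  · rintro ⟨⟨h1, h2⟩, h3⟩
    exact ⟨h3, (Nat.floor_lt hy).1 h1, (Nat.le_floor_iff' h3.ne_zero).1 h2⟩
  · rintro ⟨h3, h1, h2⟩
    exact ⟨⟨(Nat.floor_lt hy).2 h1, (Nat.le_floor_iff' h3.ne_zero).2 h2⟩, h3⟩

/-- Mertens' first theorem, for the primes of an interval. -/
theorem exists_abs_sum_primesIoc_log_div_sub_le : ∃ C : ℝ, ∀ y z : ℝ, 1 ≤ y → y ≤ z →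
    |∑ p ∈ primesIoc y z, Real.log p / p - (Real.log z - Real.log y)| ≤ C := by
  obtain ⟨K, hK⟩ := exists_le_sum_log_div_prime
  -- Rounding costs at most log 2, since t < ⌊t⌋ + 1 ≤ 2⌊t⌋.
  have hlog : ∀ t : ℝ, 1 ≤ t → Real.log ⌊t⌋₊ ≤ Real.log t ∧
      Real.log t ≤ Real.log ⌊t⌋₊ + Real.log 2 := by
    intro t ht
    have h1 : (1 : ℝ) ≤ ⌊t⌋₊ := by exact_mod_cast (Nat.one_le_floor_iff t).2 ht
    refine ⟨Real.log_le_log (by linarith) (Nat.floor_le (by linarith)), ?_⟩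
    rw [← Real.log_mul (by linarith) (by norm_num)]
    exact Real.log_le_log (by linarith) (by linarith [Nat.lt_floor_add_one t])
  refine ⟨|K| + Real.log 4 + Real.log 2, fun y z hy hyz => ?_⟩
  have hfl : ⌊y⌋₊ ≤ ⌊z⌋₊ := Nat.floor_le_floor hyz
  have hne : ∀ t : ℝ, 1 ≤ t → ⌊t⌋₊ ≠ 0 := fun t ht =>
    Nat.one_le_iff_ne_zero.1 ((Nat.one_le_floor_iff t).2 ht)
  have hsplit : ∑ p ∈ (Finset.Icc 0 ⌊z⌋₊).filter Nat.Prime, Real.log p / p =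
      ∑ p ∈ (Finset.Icc 0 ⌊y⌋₊).filter Nat.Prime, Real.log p / p +
      ∑ p ∈ primesIoc y z, Real.log p / p := by
    rw [primesIoc, ← Finset.sum_union]
    · congr 1
      rw [← Finset.filter_union]
      congr 1
      ext a
      simp only [Finset.mem_Icc, Finset.mem_union, Finset.mem_Ioc]
      omega
    · refine Finset.disjoint_filter_filter (Finset.disjoint_left.2 fun a ha hb => ?_)
      simp only [Finset.mem_Icc, Finset.mem_Ioc] at ha hb
      omega
  have hz := hy.trans hyz
  have a1 := hK _ (hne y hy)
  have a2 := hK _ (hne z hz)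
  have b1 := sum_log_div_prime_le (hne y hy)
  have b2 := sum_log_div_prime_le (hne z hz)
  have c1 := hlog y hy
  have c2 := hlog z hz
  have := le_abs_self K
  rw [abs_le]
  constructor <;> linarith [c1.1, c1.2, c2.1, c2.2]

/-! ### Smooth numbers and Buchstab's identity -/

/-- All prime factors of `n` are at most `y`. -/
def IsSmooth (y : ℝ) (n : ℕ) : Prop := ∀ p : ℕ, p.Prime → p ∣ n → (p : ℝ) ≤ y

/-- The number of `y`-smooth positive integers up to `x`, usually denoted by `Ψ(x, y)`. -/
noncomputable def smoothCount (x y : ℝ) : ℕ := countUpTo (IsSmooth y) x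

theorem countUpTo_mono {P Q : ℕ → Prop} {x : ℝ}
    (h : ∀ n : ℕ, 1 ≤ n → (n : ℝ) ≤ x → P n → Q n) : countUpTo P x ≤ countUpTo Q x := by
  classical
  refine Finset.card_le_card fun n hn => ?_
  rw [Finset.mem_filter, Finset.mem_Icc] at hn ⊢
  exact ⟨hn.1, h n hn.1.1 ((Nat.le_floor_iff' (by omega)).1 hn.1.2) hn.2⟩

theorem countUpTo_le_add {P Q R : ℕ → Prop} {x : ℝ}
    (h : ∀ n : ℕ, 1 ≤ n → (n : ℝ) ≤ x → P n → Q n ∨ R n) :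
    countUpTo P x ≤ countUpTo Q x + countUpTo R x := by
  classical
  refine (Finset.card_le_card fun n hn => ?_).trans (Finset.card_union_le _ _)
  simp only [Finset.mem_union, Finset.mem_filter, Finset.mem_Icc] at hn ⊢
  rcases h n hn.1.1 ((Nat.le_floor_iff' (by omega)).1 hn.1.2) hn.2 with h | h
  · exact Or.inl ⟨hn.1, h⟩
  · exact Or.inr ⟨hn.1, h⟩

theorem countUpTo_le {P : ℕ → Prop} {x : ℝ} (hx : 0 ≤ x) : (countUpTo P x : ℝ) ≤ x := by
  classical
  have h : countUpTo P x ≤ ⌊x⌋₊ := by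
    simpa [countUpTo] using Finset.card_filter_le (Finset.Icc 1 ⌊x⌋₊) P
  exact (Nat.cast_le.2 h).trans (Nat.floor_le hx)

theorem countUpTo_le_of_bounded {P : ℕ → Prop} {x b : ℝ} (hb : 0 ≤ b)
    (h : ∀ n : ℕ, 1 ≤ n → (n : ℝ) ≤ x → P n → (n : ℝ) ≤ b) : (countUpTo P x : ℝ) ≤ b := by
  classical
  have h1 : countUpTo P x ≤ (Finset.Icc 1 ⌊b⌋₊).card := by
    refine Finset.card_le_card fun n hn => ?_
    simp only [Finset.mem_filter, Finset.mem_Icc] at hn ⊢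
    exact ⟨hn.1.1, Nat.le_floor (h n hn.1.1 ((Nat.le_floor_iff' (by omega)).1 hn.1.2) hn.2)⟩
  rw [Nat.card_Icc, Nat.add_sub_cancel] at h1
  exact (Nat.cast_le.2 h1).trans (Nat.floor_le hb)

theorem IsSmooth.mono {y z : ℝ} (h : y ≤ z) {n : ℕ} (hn : IsSmooth y n) : IsSmooth z n :=
  fun p hp hd => (hn p hp hd).trans h

theorem smoothCount_mono {x y z : ℝ} (h : y ≤ z) : smoothCount x y ≤ smoothCount x z :=
  countUpTo_mono fun _ _ _ hn => hn.mono h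

theorem smoothCount_le {x y : ℝ} (hx : 0 ≤ x) : (smoothCount x y : ℝ) ≤ x := countUpTo_le hx

theorem smoothCount_eq_floor {x y : ℝ} (hx : 0 ≤ x) (h : x ≤ y) : smoothCount x y = ⌊x⌋₊ := by
  classical
  rw [smoothCount, countUpTo, Finset.filter_true_of_mem, Nat.card_Icc, Nat.add_sub_cancel]
  intro n hn p _ hd
  rw [Finset.mem_Icc] at hn
  have h1 : (p : ℝ) ≤ n := by exact_mod_cast Nat.le_of_dvd hn.1 hd
  have h2 : (n : ℝ) ≤ x := (Nat.le_floor_iff hx).1 hn.2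
  linarith

theorem le_largestPrimeFactor {n p : ℕ} (hn : n ≠ 0) (hp : p.Prime) (hd : p ∣ n) :
    p ≤ largestPrimeFactor n := by
  have h1 : n ≠ 1 := fun h => hp.one_lt.ne' (Nat.dvd_one.1 (h ▸ hd))
  rw [largestPrimeFactor, if_neg h1]
  exact Finset.le_sup (f := id) (Nat.mem_primeFactors.2 ⟨hp, hd, hn⟩)

theorem largestPrimeFactor_mem {n : ℕ} (hn : 2 ≤ n) : largestPrimeFactor n ∈ n.primeFactors := by
  rw [largestPrimeFactor, if_neg (by omega)]
  have hne : n.primeFactors.Nonempty := Nat.nonempty_primeFactors.2 (by omega)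
  obtain ⟨p, hp, h⟩ := Finset.exists_mem_eq_sup _ hne id
  rw [h]
  exact hp

theorem largestPrimeFactor_prime {n : ℕ} (hn : 2 ≤ n) : (largestPrimeFactor n).Prime :=
  Nat.prime_of_mem_primeFactors (largestPrimeFactor_mem hn)

theorem largestPrimeFactor_dvd {n : ℕ} (hn : 2 ≤ n) : largestPrimeFactor n ∣ n :=
  Nat.dvd_of_mem_primeFactors (largestPrimeFactor_mem hn)

theorem largestPrimeFactor_le_iff {n : ℕ} (hn : 1 ≤ n) {y : ℝ} (hy : 1 ≤ y) :
    (largestPrimeFactor n : ℝ) ≤ y ↔ IsSmooth y n := by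
  constructor
  · intro h p hp hd
    have : (p : ℝ) ≤ largestPrimeFactor n := by
      exact_mod_cast le_largestPrimeFactor (by omega) hp hd
    linarith
  · intro h
    rcases hn.eq_or_lt with rfl | h2
    · simpa [largestPrimeFactor] using hy
    · exact h _ (largestPrimeFactor_prime h2) (largestPrimeFactor_dvd h2)

theorem largestPrimeFactor_mul_eq {m p : ℕ} (hp : p.Prime) (hm : 1 ≤ m) (h : IsSmooth p m) :
    largestPrimeFactor (p * m) = p := by
  have h2 : 2 ≤ p * m := by nlinarith [hp.two_le]
  refine le_antisymm ?_ (le_largestPrimeFactor (by omega) hp (dvd_mul_right _ _))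
  rcases (largestPrimeFactor_prime h2).dvd_mul.1 (largestPrimeFactor_dvd h2) with h' | h'
  · exact Nat.le_of_dvd hp.pos h'
  · exact_mod_cast h _ (largestPrimeFactor_prime h2) h'

/-- Buchstab's identity. -/
theorem smoothCount_eq_add_sum {x y z : ℝ} (hx : 0 ≤ x) (hy : 1 ≤ y) (hyz : y ≤ z) :
    smoothCount x z = smoothCount x y + ∑ p ∈ primesIoc y z, smoothCount (x / p) p := by
  classical
  set A := (Finset.Icc 1 ⌊x⌋₊).filter (IsSmooth z) with hA
  have h1 : smoothCount x z = A.card := by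
    rw [smoothCount, countUpTo, hA]
  have h2 : smoothCount x y = (A.filter (IsSmooth y)).card := by
    rw [smoothCount, countUpTo, hA, Finset.filter_filter]
    congr 1
    ext n
    simp only [Finset.mem_filter, and_congr_right_iff]
    exact fun _ => ⟨fun h => ⟨h.mono hyz, h⟩, fun h => h.2⟩
  have hB : ∀ n ∈ A.filter (fun n => ¬ IsSmooth y n), 2 ≤ n := by
    intro n hn
    rw [Finset.mem_filter, hA, Finset.mem_filter, Finset.mem_Icc] at hn
    by_contra h
    obtain rfl : n = 1 := by omega
    refine hn.2 fun p hp hd => ?_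
    rw [Nat.dvd_one.1 hd]
    simpa using hy
  -- The z-smooth numbers that are not y-smooth are fibred over their largest prime factor p; the
  -- fibre is the set of p * m with m ≤ x/p and m p-smooth.
  have hmaps : Set.MapsTo largestPrimeFactor (A.filter (fun n => ¬ IsSmooth y n) : Set ℕ)
      (primesIoc y z) := by
    intro n hn
    have hn2 := hB n hn
    rw [Finset.mem_coe, Finset.mem_filter, hA, Finset.mem_filter] at hn
    rw [Finset.mem_coe, mem_primesIoc (by linarith)]
    refine ⟨largestPrimeFactor_prime hn2, ?_,
      (largestPrimeFactor_le_iff (by omega) (hy.trans hyz)).2 hn.1.2⟩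
    by_contra h
    exact hn.2 ((largestPrimeFactor_le_iff (by omega) hy).1 (not_lt.1 h))
  rw [h1, h2, ← Finset.card_filter_add_card_filter_not (s := A) (IsSmooth y),
    Finset.card_eq_sum_card_fiberwise hmaps]
  congr 1
  refine Finset.sum_congr rfl fun p hp => ?_
  obtain ⟨hpp, hyp, hpz⟩ := (mem_primesIoc (by linarith)).1 hp
  have hp0 : (0 : ℝ) < p := by exact_mod_cast hpp.pos
  rw [smoothCount, countUpTo]
  symm
  refine Finset.card_nbij (fun m => p * m) ?_ ?_ ?_
  · intro m hm
    rw [Finset.mem_coe, Finset.mem_filter, Finset.mem_Icc] at hm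
    obtain ⟨⟨hm1, hm2⟩, hm3⟩ := hm
    have hmx : (m : ℝ) ≤ x / p := (Nat.le_floor_iff' (by omega)).1 hm2
    have hlp := largestPrimeFactor_mul_eq hpp hm1 hm3
    rw [Finset.mem_coe, Finset.mem_filter, Finset.mem_filter, hA, Finset.mem_filter,
      Finset.mem_Icc]
    have hpos : 1 ≤ p * m := Nat.mul_pos hpp.pos hm1
    refine ⟨⟨⟨⟨hpos, Nat.le_floor ?_⟩, ?_⟩, ?_⟩, hlp⟩
    · rw [le_div_iff₀ hp0] at hmx
      push_cast
      linarith
    · exact (largestPrimeFactor_le_iff hpos (hy.trans hyz)).1 (by rwa [hlp])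
    · exact fun h => absurd (h p hpp (dvd_mul_right _ _)) (not_le.2 hyp)
  · intro a _ b _ h
    exact Nat.eq_of_mul_eq_mul_left hpp.pos h
  · intro n hn
    have hn2 := hB n (Finset.mem_filter.1 hn).1
    rw [Finset.mem_coe, Finset.mem_filter, Finset.mem_filter, hA, Finset.mem_filter,
      Finset.mem_Icc] at hn
    obtain ⟨⟨⟨⟨hn1, hnx⟩, -⟩, -⟩, hlp⟩ := hn
    obtain ⟨m, rfl⟩ : p ∣ n := hlp ▸ largestPrimeFactor_dvd hn2
    have hm : 1 ≤ m := Nat.pos_of_ne_zero (by rintro rfl; simp at hn1)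
    refine ⟨m, ?_, rfl⟩
    rw [Finset.mem_coe, Finset.mem_filter, Finset.mem_Icc]
    refine ⟨⟨hm, Nat.le_floor ?_⟩, fun q hq hd => ?_⟩
    · have := (Nat.le_floor_iff hx).1 hnx
      rw [le_div_iff₀ hp0]
      push_cast at this
      linarith
    · have := le_largestPrimeFactor (by omega) hq (hd.mul_left p)
      rw [hlp] at this
      exact_mod_cast this

/-! ### Dickman's theorem -/

/-- By compactness, limits of bounded functions can be named before convergence is known. -/
theorem Ultrafilter.exists_tendsto_of_eventually_mem_Icc {α : Type*} (f : Ultrafilter α)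
    {g : α → ℝ} {a b : ℝ} (h : ∀ᶠ x in (f : Filter α), g x ∈ Set.Icc a b) :
    ∃ l, Tendsto g f (𝓝 l) := by
  obtain ⟨l, -, hl⟩ := isCompact_Icc.ultrafilter_le_nhds (f.map g) (le_principal_iff.2 h)
  exact ⟨l, hl⟩

/-- Since u log p ≤ log x on this range, 1/p ≥ (u / log x) (log p / p). The bounded error in
Mertens' theorem is divided by log x and disappears in the limit; the crude main term suffices
because v will tend to u. -/
theorem primesIoc_sum_inv_ge {C : ℝ}
    (hC : ∀ y z : ℝ, 1 ≤ y → y ≤ z →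
      |∑ p ∈ primesIoc y z, Real.log p / p - (Real.log z - Real.log y)| ≤ C)
    {u v x : ℝ} (hu : 1 ≤ u) (huv : u ≤ v) (hx : 1 < x) :
    (v - u) / v - C * u / Real.log x ≤
      ∑ p ∈ primesIoc (x ^ (1 / v)) (x ^ (1 / u)), (1 : ℝ) / p := by
  have hx0 : 0 < x := by linarith
  have hl := Real.log_pos hx
  have hv1 : 1 ≤ v := hu.trans huv
  have hM := (abs_le.1 (hC (x ^ (1 / v)) (x ^ (1 / u))
    (Real.one_le_rpow hx.le (by positivity))
    (Real.rpow_le_rpow_of_exponent_le hx.le (one_div_le_one_div_of_le (by linarith) huv)))).1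
  rw [Real.log_rpow hx0, Real.log_rpow hx0] at hM
  have h1 : (u / Real.log x) * ∑ p ∈ primesIoc (x ^ (1 / v)) (x ^ (1 / u)), Real.log p / p ≤
      ∑ p ∈ primesIoc (x ^ (1 / v)) (x ^ (1 / u)), (1 : ℝ) / p := by
    rw [Finset.mul_sum]
    refine Finset.sum_le_sum fun p hp => ?_
    obtain ⟨hpp, -, hpz⟩ := (mem_primesIoc (by positivity)).1 hp
    have hp0 : (0 : ℝ) < p := by exact_mod_cast hpp.pos
    have h2 := Real.log_le_log hp0 hpz
    rw [Real.log_rpow hx0] at h2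
    have h3 : u / Real.log x * Real.log p ≤ 1 := by
      rw [div_mul_eq_mul_div, div_le_one hl]
      calc u * Real.log p ≤ u * (1 / u * Real.log x) := by gcongr
        _ = _ := by field_simp
    calc _ = (u / Real.log x * Real.log p) / p := by ring
      _ ≤ _ := by gcongr
  refine le_trans (le_of_eq ?_) ((mul_le_mul_of_nonneg_left (show 1 / u * Real.log x -
    1 / v * Real.log x - C ≤ _ by linarith) (show 0 ≤ u / Real.log x by positivity)).trans h1)
  have hv0 : v ≠ 0 := by linarith
  have hu0 : u ≠ 0 := by linarith
  field_simp

theorem primesIoc_sum_inv_le {C : ℝ}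
    (hC : ∀ y z : ℝ, 1 ≤ y → y ≤ z →
      |∑ p ∈ primesIoc y z, Real.log p / p - (Real.log z - Real.log y)| ≤ C)
    {u v x : ℝ} (hu : 1 ≤ u) (huv : u ≤ v) (hx : 1 < x) :
    ∑ p ∈ primesIoc (x ^ (1 / v)) (x ^ (1 / u)), (1 : ℝ) / p ≤
      (v - u) / u + C * v / Real.log x := by
  have hx0 : 0 < x := by linarith
  have hl := Real.log_pos hx
  have hv1 : 1 ≤ v := hu.trans huv
  have hM := (abs_le.1 (hC (x ^ (1 / v)) (x ^ (1 / u))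
    (Real.one_le_rpow hx.le (by positivity))
    (Real.rpow_le_rpow_of_exponent_le hx.le (one_div_le_one_div_of_le (by linarith) huv)))).2
  rw [Real.log_rpow hx0, Real.log_rpow hx0] at hM
  have h1 : ∑ p ∈ primesIoc (x ^ (1 / v)) (x ^ (1 / u)), (1 : ℝ) / p ≤
      (v / Real.log x) * ∑ p ∈ primesIoc (x ^ (1 / v)) (x ^ (1 / u)), Real.log p / p := by
    rw [Finset.mul_sum]
    refine Finset.sum_le_sum fun p hp => ?_
    obtain ⟨hpp, hyp, -⟩ := (mem_primesIoc (by positivity)).1 hp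
    have hp0 : (0 : ℝ) < p := by exact_mod_cast hpp.pos
    have h2 := Real.log_le_log (by positivity) hyp.le
    rw [Real.log_rpow hx0] at h2
    have h3 : 1 ≤ v / Real.log x * Real.log p := by
      rw [div_mul_eq_mul_div, one_le_div hl]
      calc Real.log x = v * (1 / v * Real.log x) := by field_simp
        _ ≤ _ := by gcongr
    calc (1 : ℝ) / p ≤ (v / Real.log x * Real.log p) / p := by gcongr
      _ = _ := by ring
  refine (h1.trans (mul_le_mul_of_nonneg_left (show _ ≤ 1 / u * Real.log x -
    1 / v * Real.log x + C by linarith) (show 0 ≤ v / Real.log x by positivity))).trans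
    (le_of_eq ?_)
  have hv0 : v ≠ 0 := by linarith
  have hu0 : u ≠ 0 := by linarith
  field_simp

theorem tendsto_rpow_div_atTop {u : ℝ} (hu : 1 < u) :
    Tendsto (fun x : ℝ => x / x ^ (1 / u)) atTop atTop := by
  have h : 0 < 1 - 1 / u := by
    rw [sub_pos, div_lt_one (by linarith)]
    exact hu
  refine (tendsto_rpow_atTop h).congr' ?_
  filter_upwards [eventually_gt_atTop 0] with x hx
  rw [Real.rpow_sub hx, Real.rpow_one]

/-- p^u ≤ x is the same as p^(u-1) ≤ x/p. This shift from u to u - 1 is the source of the delay in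
the equation for ρ. -/
theorem le_div_rpow_of_le_rpow {u x p : ℝ} (hu : 1 < u) (hp : 0 < p) (hx : 0 < x)
    (h : p ≤ x ^ (1 / u)) : p ≤ (x / p) ^ (1 / (u - 1)) := by
  have hu1 : 0 < u - 1 := by linarith
  rw [one_div, Real.le_rpow_inv_iff_of_pos hp.le (by positivity) hu1, le_div_iff₀ hp,
    ← Real.rpow_add_one hp.ne', sub_add_cancel,
    ← Real.le_rpow_inv_iff_of_pos hp.le hx.le (by linarith), ← one_div]
  exact h

theorem div_rpow_le_of_rpow_le {u x p : ℝ} (hu : 1 < u) (hp : 0 < p) (hx : 0 < x)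
    (h : x ^ (1 / u) ≤ p) : (x / p) ^ (1 / (u - 1)) ≤ p := by
  have hu1 : 0 < u - 1 := by linarith
  rw [one_div, Real.rpow_inv_le_iff_of_pos (by positivity) hp.le hu1, div_le_iff₀ hp,
    ← Real.rpow_add_one hp.ne', sub_add_cancel,
    ← Real.rpow_inv_le_iff_of_pos hx.le hp.le (by linarith), ← one_div]
  exact h

theorem smoothCount_rpow_sub_eq {u v x : ℝ} (hu : 1 ≤ u) (huv : u ≤ v) (hx : 1 ≤ x) :
    (smoothCount x (x ^ (1 / u)) : ℝ) / x - (smoothCount x (x ^ (1 / v)) : ℝ) / x =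
      ∑ p ∈ primesIoc (x ^ (1 / v)) (x ^ (1 / u)), (smoothCount (x / p) p : ℝ) / x := by
  have hv : 1 ≤ v := hu.trans huv
  rw [smoothCount_eq_add_sum (by linarith) (Real.one_le_rpow hx (by positivity))
    (Real.rpow_le_rpow_of_exponent_le hx (one_div_le_one_div_of_le (by linarith) huv)),
    ← Finset.sum_div, ← sub_div]
  push_cast
  ring

/-- The trivial bound Ψ(x/p, p) ≤ x/p makes the limit function Lipschitz down to u = 1, where the
finer bounds below are not available. -/
theorem smoothCount_rpow_sub_le {u v x : ℝ} (hu : 1 ≤ u) (huv : u ≤ v) (hx : 1 ≤ x) :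
    (smoothCount x (x ^ (1 / u)) : ℝ) / x - (smoothCount x (x ^ (1 / v)) : ℝ) / x ≤
      ∑ p ∈ primesIoc (x ^ (1 / v)) (x ^ (1 / u)), (1 : ℝ) / p := by
  rw [smoothCount_rpow_sub_eq hu huv hx]
  refine Finset.sum_le_sum fun p hp => ?_
  have hx0 : 0 < x := by linarith
  calc (smoothCount (x / p) p : ℝ) / x ≤ (x / p) / x := by
        gcongr
        exact smoothCount_le (by positivity)
    _ = 1 / p := by field_simp

/-- In Buchstab's sum x/p ≥ x^(1-1/u), which tends to infinity as u > 1, so the hypothesis on `r`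
applies to all p simultaneously. -/
theorem eventually_smoothCount_rpow_sub_le {u v r : ℝ} (hu : 1 < u) (huv : u ≤ v)
    (hr : ∀ᶠ x : ℝ in atTop, (smoothCount x (x ^ (1 / (u - 1))) : ℝ) / x ≤ r) :
    ∀ᶠ x : ℝ in atTop,
      (smoothCount x (x ^ (1 / u)) : ℝ) / x - (smoothCount x (x ^ (1 / v)) : ℝ) / x ≤
        r * ∑ p ∈ primesIoc (x ^ (1 / v)) (x ^ (1 / u)), (1 : ℝ) / p := by
  obtain ⟨X, hX⟩ := eventually_atTop.1 hr
  filter_upwards [(tendsto_rpow_div_atTop hu).eventually_ge_atTop X, eventually_ge_atTop 1]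
    with x hxX hx
  rw [smoothCount_rpow_sub_eq hu.le huv hx, Finset.mul_sum]
  refine Finset.sum_le_sum fun p hp => ?_
  have hx0 : 0 < x := by linarith
  obtain ⟨hpp, -, hpz⟩ := (mem_primesIoc (by positivity)).1 hp
  have hp0 : (0 : ℝ) < p := by exact_mod_cast hpp.pos
  have h1 : X ≤ x / p := hxX.trans (by gcongr)
  have h2 := hX _ h1
  rw [div_le_iff₀ (by positivity)] at h2
  calc (smoothCount (x / p) p : ℝ) / x
      ≤ (smoothCount (x / p) ((x / p) ^ (1 / (u - 1))) : ℝ) / x := by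
        gcongr
        exact smoothCount_mono (le_div_rpow_of_le_rpow hu hp0 hx0 hpz)
    _ ≤ (r * (x / p)) / x := by gcongr
    _ = r * (1 / p) := by field_simp

theorem eventually_le_smoothCount_rpow_sub {u v r : ℝ} (hu : 1 < u) (huv : u ≤ v)
    (hr : ∀ᶠ x : ℝ in atTop, r ≤ (smoothCount x (x ^ (1 / (v - 1))) : ℝ) / x) :
    ∀ᶠ x : ℝ in atTop,
      r * ∑ p ∈ primesIoc (x ^ (1 / v)) (x ^ (1 / u)), (1 : ℝ) / p ≤
        (smoothCount x (x ^ (1 / u)) : ℝ) / x - (smoothCount x (x ^ (1 / v)) : ℝ) / x := by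
  obtain ⟨X, hX⟩ := eventually_atTop.1 hr
  filter_upwards [(tendsto_rpow_div_atTop hu).eventually_ge_atTop X, eventually_ge_atTop 1]
    with x hxX hx
  rw [smoothCount_rpow_sub_eq hu.le huv hx, Finset.mul_sum]
  refine Finset.sum_le_sum fun p hp => ?_
  have hx0 : 0 < x := by linarith
  obtain ⟨hpp, hyp, hpz⟩ := (mem_primesIoc (by positivity)).1 hp
  have hp0 : (0 : ℝ) < p := by exact_mod_cast hpp.pos
  have h1 : X ≤ x / p := hxX.trans (by gcongr)
  have h2 := hX _ h1
  rw [le_div_iff₀ (by positivity)] at h2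
  calc r * (1 / p) = (r * (x / p)) / x := by field_simp
    _ ≤ (smoothCount (x / p) ((x / p) ^ (1 / (v - 1))) : ℝ) / x := by gcongr
    _ ≤ (smoothCount (x / p) p : ℝ) / x := by
        gcongr
        exact smoothCount_mono (div_rpow_le_of_rpow_le (hu.trans_le huv) hp0 hx0 hyp.le)

theorem tendsto_smoothCount_rpow_of_le_one {u : ℝ} (hu : 0 < u) (hu1 : u ≤ 1) :
    Tendsto (fun x : ℝ => (smoothCount x (x ^ (1 / u)) : ℝ) / x) atTop (𝓝 1) := by
  refine (tendsto_nat_floor_div_atTop (R := ℝ)).congr' ?_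
  filter_upwards [eventually_ge_atTop 1] with x hx
  rw [smoothCount_eq_floor (by linarith)]
  exact Real.self_le_rpow_of_one_le hx ((one_le_div hu).2 hu1)

theorem dickman_continuousAt {u : ℝ} (hu : 0 < u) : ContinuousAt dickman u :=
  dickman_continuousOn.continuousAt (Ici_mem_nhds hu)

/-- A function whose difference quotients are bounded by the values of a continuous function at
the two end points has that function as its derivative. -/
theorem hasDerivAt_of_slope_bounds {f h : ℝ → ℝ} {s : Set ℝ} {u : ℝ} (hs : s ∈ 𝓝 u)
    (hc : ContinuousAt h u)
    (hf : ∀ a ∈ s, ∀ b ∈ s, a < b → h a * (b - a) ≤ f b - f a ∧ f b - f a ≤ h b * (b - a)) :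
    HasDerivAt f (h u) u := by
  rw [hasDerivAt_iff_isLittleO, Asymptotics.isLittleO_iff]
  intro ε hε
  filter_upwards [hs, Metric.continuousAt_iff'.1 hc ε hε] with t ht hd
  rw [Real.dist_eq, abs_lt] at hd
  have hu := mem_of_mem_nhds hs
  rw [Real.norm_eq_abs, Real.norm_eq_abs, smul_eq_mul]
  rcases lt_trichotomy t u with h1 | rfl | h1
  · obtain ⟨h2, h3⟩ := hf t ht u hu h1
    rw [abs_of_neg (sub_neg.2 h1), abs_le]
    constructor <;> nlinarith
  · simp
  · obtain ⟨h2, h3⟩ := hf u hu t ht h1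
    rw [abs_of_pos (sub_pos.2 h1), abs_le]
    constructor <;> nlinarith

/-- Extends the range by one unit: the slopes of any ultrafilter limit are controlled by values of ρ
already known to be limits. -/
theorem tendsto_smoothCount_rpow_step {k : ℝ}
    (ih : ∀ w : ℝ, 0 < w → w ≤ k →
      Tendsto (fun x : ℝ => (smoothCount x (x ^ (1 / w)) : ℝ) / x) atTop (𝓝 (dickman w)))
    {t : ℝ} (ht1 : 1 < t) (htk : t ≤ k + 1) :
    Tendsto (fun x : ℝ => (smoothCount x (x ^ (1 / t)) : ℝ) / x) atTop (𝓝 (dickman t)) := by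
  rw [tendsto_iff_ultrafilter]
  intro f hf
  obtain ⟨C, hC⟩ := exists_abs_sum_primesIoc_log_div_sub_le
  have hex : ∀ u : ℝ, ∃ l,
      Tendsto (fun x : ℝ => (smoothCount x (x ^ (1 / u)) : ℝ) / x) f (𝓝 l) := by
    intro u
    refine f.exists_tendsto_of_eventually_mem_Icc (a := 0) (b := 1) (hf ?_)
    filter_upwards [eventually_gt_atTop 0] with x hx
    exact ⟨by positivity, (div_le_one hx).2 (smoothCount_le hx.le)⟩
  choose L hL using hex
  have hlog : ∀ a b : ℝ, Tendsto (fun x : ℝ => a * b / Real.log x) f (𝓝 0) := fun a b =>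
    (tendsto_const_nhds.div_atTop Real.tendsto_log_atTop).mono_left hf
  have hsum : ∀ u v : ℝ, 1 ≤ u → u ≤ v → ∃ σ, (v - u) / v ≤ σ ∧ σ ≤ (v - u) / u ∧
      Tendsto (fun x : ℝ => ∑ p ∈ primesIoc (x ^ (1 / v)) (x ^ (1 / u)), (1 : ℝ) / p) f (𝓝 σ) := by
    intro u v hu huv
    have h1 : Tendsto (fun x : ℝ => (v - u) / v - C * u / Real.log x) f (𝓝 ((v - u) / v)) := by
      simpa using tendsto_const_nhds.sub (hlog C u)
    have h2 : Tendsto (fun x : ℝ => (v - u) / u + C * v / Real.log x) f (𝓝 ((v - u) / u)) := by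
      simpa using tendsto_const_nhds.add (hlog C v)
    have hgt := hf (eventually_gt_atTop (1 : ℝ))
    obtain ⟨σ, hσ⟩ := f.exists_tendsto_of_eventually_mem_Icc
      (g := fun x : ℝ => ∑ p ∈ primesIoc (x ^ (1 / v)) (x ^ (1 / u)), (1 : ℝ) / p)
      (a := 0) (b := (v - u) / u + 1) (by
        filter_upwards [hgt, (hlog C v).eventually (gt_mem_nhds one_pos)] with x hx hx1
        refine ⟨Finset.sum_nonneg fun p _ => by positivity, ?_⟩
        linarith [primesIoc_sum_inv_le hC hu huv hx])
    refine ⟨σ, le_of_tendsto_of_tendsto h1 hσ ?_, le_of_tendsto_of_tendsto hσ h2 ?_, hσ⟩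
    · filter_upwards [hgt] with x hx using primesIoc_sum_inv_ge hC hu huv hx
    · filter_upwards [hgt] with x hx using primesIoc_sum_inv_le hC hu huv hx
  have hnn : ∀ w : ℝ, 0 < w → w ≤ k → 0 ≤ dickman w := fun w h0 hw =>
    ge_of_tendsto (ih w h0 hw) (by
      filter_upwards [eventually_gt_atTop 0] with x hx
      positivity)
  have hcrude : ∀ u v : ℝ, 1 ≤ u → u ≤ v → 0 ≤ L u - L v ∧ L u - L v ≤ v - u := by
    intro u v hu huv
    obtain ⟨σ, -, hσ, hσt⟩ := hsum u v hu huv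
    have hge := hf (eventually_ge_atTop (1 : ℝ))
    constructor
    · refine ge_of_tendsto ((hL u).sub (hL v)) ?_
      filter_upwards [hge] with x hx
      rw [smoothCount_rpow_sub_eq hu huv hx]
      exact Finset.sum_nonneg fun p _ => by positivity
    · have h1 : L u - L v ≤ σ := by
        refine le_of_tendsto_of_tendsto ((hL u).sub (hL v)) hσt ?_
        filter_upwards [hge] with x hx using smoothCount_rpow_sub_le hu huv hx
      exact (h1.trans hσ).trans (div_le_self (by linarith) hu)
  have hfine : ∀ u v : ℝ, 1 < u → u ≤ v → v ≤ k + 1 →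
      dickman (v - 1) / v * (v - u) ≤ L u - L v ∧ L u - L v ≤ dickman (u - 1) / u * (v - u) := by
    intro u v hu huv hv
    obtain ⟨σ, hσ1, hσ2, hσt⟩ := hsum u v hu.le huv
    constructor
    · have h1 : dickman (v - 1) * σ ≤ L u - L v := by
        -- A limit gives eventual bounds only for r strictly below it; r then tends to `dickman (v -
        -- 1)` from the left.
        have hr : ∀ r < dickman (v - 1), r * σ ≤ L u - L v := fun r hr =>
          le_of_tendsto_of_tendsto (hσt.const_mul r) ((hL u).sub (hL v))
            (hf (eventually_le_smoothCount_rpow_sub hu huv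
              (((ih (v - 1) (by linarith) (by linarith)).eventually (lt_mem_nhds hr)).mono
                fun _ h => h.le)))
        exact le_of_tendsto (x := 𝓝[<] dickman (v - 1)) (f := fun r => r * σ)
          (((continuous_id.mul continuous_const).tendsto _).mono_left nhdsWithin_le_nhds)
          (by filter_upwards [self_mem_nhdsWithin] with r h using hr r h)
      refine le_trans ?_ h1
      calc _ = dickman (v - 1) * ((v - u) / v) := by ring
        _ ≤ _ := mul_le_mul_of_nonneg_left hσ1 (hnn _ (by linarith) (by linarith))
    · have h1 : L u - L v ≤ dickman (u - 1) * σ := by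
        have hr : ∀ r > dickman (u - 1), L u - L v ≤ r * σ := fun r hr =>
          le_of_tendsto_of_tendsto ((hL u).sub (hL v)) (hσt.const_mul r)
            (hf (eventually_smoothCount_rpow_sub_le hu huv
              (((ih (u - 1) (by linarith) (by linarith)).eventually (gt_mem_nhds hr)).mono
                fun _ h => h.le)))
        exact ge_of_tendsto (x := 𝓝[>] dickman (u - 1)) (f := fun r => r * σ)
          (((continuous_id.mul continuous_const).tendsto _).mono_left nhdsWithin_le_nhds)
          (by filter_upwards [self_mem_nhdsWithin] with r h using hr r h)
      refine h1.trans ?_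
      calc _ ≤ dickman (u - 1) * ((v - u) / u) :=
            mul_le_mul_of_nonneg_left hσ2 (hnn _ (by linarith) (by linarith))
        _ = _ := by ring
  have hL1 : L 1 = 1 :=
    tendsto_nhds_unique (hL 1) ((tendsto_smoothCount_rpow_of_le_one one_pos le_rfl).mono_left hf)
  have hcont : ContinuousOn (fun u => L u - dickman u) (Set.Icc 1 t) := by
    refine ContinuousOn.sub ?_ (dickman_continuousOn.mono fun u hu => by
      exact (zero_le_one.trans hu.1 : (0 : ℝ) ≤ u))
    refine LipschitzOnWith.continuousOn (K := 1)
      (LipschitzOnWith.of_dist_le_mul fun u hu v hv => ?_)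
    rw [Real.dist_eq, Real.dist_eq, NNReal.coe_one, one_mul]
    rcases le_total u v with h | h
    · have := hcrude u v hu.1 h
      rw [abs_of_nonneg this.1, abs_of_nonpos (by linarith)]
      linarith
    · have := hcrude v u hv.1 h
      rw [abs_of_nonpos (by linarith), abs_of_nonneg (by linarith)]
      linarith
  have hder : ∀ u ∈ Set.Ioo 1 t, HasDerivAt (fun u => L u - dickman u) 0 u := by
    intro u hu
    have hu0 : 0 < u - 1 := by linarith [hu.1]
    have h1 : HasDerivAt L (-dickman (u - 1) / u) u := by
      refine hasDerivAt_of_slope_bounds (h := fun u => -dickman (u - 1) / u)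
        (Ioo_mem_nhds hu.1 hu.2) ?_ ?_
      · have : ContinuousAt (fun u => dickman (u - 1)) u :=
          ContinuousAt.comp (f := fun u : ℝ => u - 1) (dickman_continuousAt hu0) (by fun_prop)
        exact this.neg.div continuousAt_id (by simp; linarith)
      · intro a ha b hb hab
        have := hfine a b ha.1 hab.le (by linarith [hb.2])
        simp only [neg_div, neg_mul]
        constructor <;> linarith [this.1, this.2]
    exact (h1.sub (dickman_hasDerivAt u hu.1)).congr_deriv (sub_self _)
  -- L - ρ has zero derivative on (1, t) and vanishes at 1, so the mean value theorem gives L t =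
  -- ρ(t).
  obtain ⟨c, -, hc⟩ := exists_hasDerivAt_eq_slope _ (fun _ => 0) ht1 hcont hder
  have h2 : L t = dickman t := by
    rw [eq_comm, div_eq_zero_iff] at hc
    rcases hc with hc | hc
    · rw [hL1, dickman_eq_one 1 zero_le_one le_rfl] at hc
      linarith
    · linarith
  exact h2 ▸ hL t

/-- Dickman's theorem. -/
theorem tendsto_smoothCount_rpow {u : ℝ} (hu : 0 < u) :
    Tendsto (fun x : ℝ => (smoothCount x (x ^ (1 / u)) : ℝ) / x) atTop (𝓝 (dickman u)) := by
  have key : ∀ k : ℕ, ∀ w : ℝ, 0 < w → w ≤ (k + 1 : ℕ) →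
      Tendsto (fun x : ℝ => (smoothCount x (x ^ (1 / w)) : ℝ) / x) atTop (𝓝 (dickman w)) := by
    intro k
    induction k with
    | zero =>
      intro w h0 h1
      have h1' : w ≤ 1 := by simpa using h1
      rw [dickman_eq_one w h0.le h1']
      exact tendsto_smoothCount_rpow_of_le_one h0 h1'
    | succ k ih =>
      intro w h0 h1
      rcases le_or_gt w 1 with h | h
      · rw [dickman_eq_one w h0.le h]
        exact tendsto_smoothCount_rpow_of_le_one h0 h
      · refine tendsto_smoothCount_rpow_step (k := (k + 1 : ℕ)) ih h ?_
        exact_mod_cast h1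
  refine key ⌊u⌋₊ u hu ?_
  push_cast
  exact (Nat.lt_floor_add_one u).le

/-! ### Positivity of ρ -/

theorem dickman_nonneg {u : ℝ} (hu : 0 < u) : 0 ≤ dickman u :=
  ge_of_tendsto (tendsto_smoothCount_rpow hu) (by
    filter_upwards [eventually_gt_atTop 0] with x hx
    positivity)

theorem dickman_antitone {w u : ℝ} (hw : 0 < w) (h : w ≤ u) : dickman u ≤ dickman w := by
  refine le_of_tendsto_of_tendsto (tendsto_smoothCount_rpow (hw.trans_le h))
    (tendsto_smoothCount_rpow hw) ?_
  filter_upwards [eventually_ge_atTop 1] with x hx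
  gcongr
  exact smoothCount_mono (Real.rpow_le_rpow_of_exponent_le hx (one_div_le_one_div_of_le hw h))

/-- ρ is nonnegative and nonincreasing, so a zero at u makes it vanish beyond u. Then ρ'(u + 1/2) =
0, and the delay equation gives a zero at u - 1/2. Repeated descent reaches the interval where ρ =
1. -/
theorem dickman_sub_half_eq_zero {u : ℝ} (hu : 1 ≤ u) (h : dickman u = 0) :
    dickman (u - 1 / 2) = 0 := by
  have h1 : dickman =ᶠ[𝓝 (u + 1 / 2)] fun _ => 0 := by
    filter_upwards [Ioi_mem_nhds (show u < u + 1 / 2 by linarith)] with v hv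
    have hv' : u < v := hv
    exact le_antisymm (h ▸ dickman_antitone (by linarith) hv'.le) (dickman_nonneg (by linarith))
  have h2 := (dickman_hasDerivAt (u + 1 / 2) (by linarith)).unique
    ((hasDerivAt_const (u + 1 / 2) (0 : ℝ)).congr_of_eventuallyEq h1)
  rw [div_eq_zero_iff, neg_eq_zero] at h2
  rcases h2 with h2 | h2
  · convert h2 using 2
    ring
  · linarith

theorem dickman_pos {u : ℝ} (hu : 0 < u) : 0 < dickman u := by
  have key : ∀ k : ℕ, ∀ w : ℝ, 0 < w → w ≤ 1 + k / 2 → dickman w ≠ 0 := by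
    intro k
    induction k with
    | zero =>
      intro w h0 h1
      rw [dickman_eq_one w h0.le (by simpa using h1)]
      exact one_ne_zero
    | succ k ih =>
      intro w h0 h1 hw
      rcases le_or_gt w 1 with h | h
      · exact ih w h0 (h.trans (by linarith [Nat.cast_nonneg (α := ℝ) k])) hw
      · refine ih (w - 1 / 2) (by linarith) ?_ (dickman_sub_half_eq_zero h.le hw)
        push_cast at h1
        linarith
  obtain ⟨k, hk⟩ := exists_nat_gt (2 * u)
  exact (dickman_nonneg hu).lt_of_ne (key k u hu (by linarith)).symm

/-! ### The density of P⁺(n) ≤ n^c -/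

/-- The bound x^{c'} is below n^c as soon as n > x^(c'/c), and the remaining n number o(x). -/
theorem smoothCount_rpow_le_largestPrimeFactor {c c' x : ℝ} (hc' : 0 < c') (hc : c' < c)
    (hx : 1 ≤ x) :
    (smoothCount x (x ^ c') : ℝ) ≤
      countUpTo (fun n => (largestPrimeFactor n : ℝ) ≤ (n : ℝ) ^ c) x + x ^ (c' / c) := by
  have hc0 : 0 < c := hc'.trans hc
  have h : smoothCount x (x ^ c') ≤
      countUpTo (fun n => (largestPrimeFactor n : ℝ) ≤ (n : ℝ) ^ c) x +
      countUpTo (fun n => (n : ℝ) ≤ x ^ (c' / c)) x := by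
    refine countUpTo_le_add fun n hn _ hs => ?_
    rcases le_or_gt (n : ℝ) (x ^ (c' / c)) with h1 | h1
    · exact Or.inr h1
    · refine Or.inl (((largestPrimeFactor_le_iff hn (Real.one_le_rpow hx hc'.le)).2 hs).trans ?_)
      calc x ^ c' = (x ^ (c' / c)) ^ c := by
            rw [← Real.rpow_mul (by linarith), div_mul_cancel₀ _ hc0.ne']
        _ ≤ _ := by gcongr
  have h2 : (countUpTo (fun n => (n : ℝ) ≤ x ^ (c' / c)) x : ℝ) ≤ x ^ (c' / c) :=
    countUpTo_le_of_bounded (by positivity) fun _ _ _ h => h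
  have h3 : (smoothCount x (x ^ c') : ℝ) ≤
      countUpTo (fun n => (largestPrimeFactor n : ℝ) ≤ (n : ℝ) ^ c) x +
      countUpTo (fun n => (n : ℝ) ≤ x ^ (c' / c)) x := by exact_mod_cast h
  linarith

theorem countUpTo_largestPrimeFactor_le {c x : ℝ} (hc : 0 < c) (hx : 1 ≤ x) :
    countUpTo (fun n => (largestPrimeFactor n : ℝ) ≤ (n : ℝ) ^ c) x ≤ smoothCount x (x ^ c) := by
  refine countUpTo_mono fun n hn hnx h => ?_
  refine (largestPrimeFactor_le_iff hn (Real.one_le_rpow hx hc.le)).1 (h.trans ?_)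
  gcongr

/-- The lower half of both limits: the loss in passing from c to c' < c is removed by continuity of
ρ at 1/c. -/
theorem eventually_lt_of_smoothCount_le {F : ℝ → ℝ} {c : ℝ} (hc : 0 < c)
    (h : ∀ c', 0 < c' → c' < c → ∃ e : ℝ → ℝ, Tendsto e atTop (𝓝 0) ∧
      ∀ᶠ x : ℝ in atTop, (smoothCount x (x ^ c') : ℝ) / x ≤ F x + e x)
    {a : ℝ} (ha : a < dickman (1 / c)) : ∀ᶠ x in atTop, a < F x := by
  have hcont : ContinuousAt (fun c' : ℝ => dickman (1 / c')) c :=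
    ContinuousAt.comp (f := fun c' : ℝ => 1 / c') (dickman_continuousAt (by positivity))
      (continuousAt_const.div continuousAt_id hc.ne')
  have hmem : ∀ᶠ c' in 𝓝[<] c, c' ∈ Set.Ioo 0 c := Ioo_mem_nhdsLT hc
  obtain ⟨c', ⟨h0, h1⟩, h2⟩ := (hmem.and
    ((hcont.eventually (lt_mem_nhds ha)).filter_mono nhdsWithin_le_nhds)).exists
  obtain ⟨e, he, hF⟩ := h c' h0 h1
  have ht := tendsto_smoothCount_rpow (show 0 < 1 / c' by positivity)
  simp only [one_div_one_div] at ht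
  have ht' := ht.sub he
  rw [sub_zero] at ht'
  filter_upwards [ht'.eventually (lt_mem_nhds h2), hF] with x h3 h4
  linarith

theorem tendsto_rpow_atTop_zero {s : ℝ} (hs : s < 0) :
    Tendsto (fun x : ℝ => x ^ s) atTop (𝓝 0) := by
  simpa using tendsto_rpow_neg_atTop (neg_pos.2 hs)

theorem tendsto_countUpTo_largestPrimeFactor {c : ℝ} (hc : 0 < c) :
    Tendsto (fun x : ℝ =>
      (countUpTo (fun n => (largestPrimeFactor n : ℝ) ≤ (n : ℝ) ^ c) x : ℝ) / x)
      atTop (𝓝 (dickman (1 / c))) := by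
  refine tendsto_order.2 ⟨fun a ha => eventually_lt_of_smoothCount_le hc (fun c' h0 h1 => ?_) ha,
    fun a ha => ?_⟩
  · refine ⟨fun x => x ^ (c' / c - 1), tendsto_rpow_atTop_zero ?_, ?_⟩
    · rw [sub_neg]
      exact (div_lt_one hc).2 h1
    · filter_upwards [eventually_ge_atTop 1] with x hx
      have hx0 : 0 < x := by linarith
      rw [Real.rpow_sub hx0, Real.rpow_one, ← add_div]
      gcongr
      exact smoothCount_rpow_le_largestPrimeFactor h0 h1 hx
  · have ht := tendsto_smoothCount_rpow (show 0 < 1 / c by positivity)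
    simp only [one_div_one_div] at ht
    filter_upwards [ht.eventually (gt_mem_nhds ha), eventually_ge_atTop 1] with x h1 hx
    refine lt_of_le_of_lt ?_ h1
    gcongr
    exact countUpTo_largestPrimeFactor_le hc hx

/-! ### Lower bound for the count of t_n ≤ n^c: linear algebra over F₂ -/

theorem squareShift_le {n E : ℕ} (hE : n ≤ E) {S : Finset ℕ} (hS : S ⊆ Finset.Ioc n E)
    (hsq : IsSquare (n * ∏ m ∈ S, m)) : squareShift n ≤ E - n :=
  Nat.sInf_le ⟨S, by rwa [Nat.add_sub_cancel' hE], hsq⟩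

theorem isSquare_of_even_factorization {n : ℕ} (hn : n ≠ 0)
    (h : ∀ p : ℕ, p.Prime → Even (n.factorization p)) : IsSquare n := by
  rw [← Nat.prod_factorization_pow_eq_self hn, Finsupp.prod]
  exact Finset.isSquare_prod _ fun p hp => (h p (Nat.prime_of_mem_primeFactors hp)).isSquare_pow p

theorem isSquare_prod_of_even {S : Finset ℕ} (hS : ∀ n ∈ S, n ≠ 0)
    (h : ∀ p : ℕ, p.Prime → Even (∑ n ∈ S, n.factorization p)) : IsSquare (∏ n ∈ S, n) := by
  refine isSquare_of_even_factorization (Finset.prod_ne_zero_iff.2 hS) fun p hp => ?_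
  rw [Nat.factorization_prod hS, Finset.sum_apply']
  exact h p hp

/-- At most `y` of the `y`-smooth numbers up to `E` cannot be completed to a square by means of
distinct larger numbers up to `E`. -/
theorem card_le_of_forall_not_isSquare {y : ℝ} (hy : 0 ≤ y) {E : ℕ} {B : Finset ℕ}
    (hB : ∀ n ∈ B, n ≠ 0 ∧ n ≤ E ∧ IsSmooth y n)
    (hsq : ∀ n ∈ B, ∀ S ⊆ Finset.Ioc n E, ¬ IsSquare (n * ∏ m ∈ S, m)) : B.card ≤ ⌊y⌋₊ := by
  classical
  -- The exponent vector mod 2 of the product of T, recorded as its set of odd coordinates. Were it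
  -- equal for two subsets of B, the product over their symmetric difference would be a square.
  let odds : Finset ℕ → Finset ℕ := fun T =>
    (Finset.Icc 1 ⌊y⌋₊).filter fun p => Odd (∑ n ∈ T, n.factorization p)
  have hinj : Set.InjOn odds (B.powerset : Set (Finset ℕ)) := by
    intro T₁ h₁ T₂ h₂ heq
    rw [Finset.mem_coe, Finset.mem_powerset] at h₁ h₂
    by_contra hne
    have hDB : symmDiff T₁ T₂ ⊆ B := symmDiff_le_sup.trans (Finset.union_subset h₁ h₂)
    have hDne : (symmDiff T₁ T₂).Nonempty := by
      rw [Finset.nonempty_iff_ne_empty]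
      exact fun h => hne (symmDiff_eq_bot.1 h)
    have hD : IsSquare (∏ n ∈ symmDiff T₁ T₂, n) := by
      refine isSquare_prod_of_even (fun n hn => (hB n (hDB hn)).1) fun p hp => ?_
      have hpar : Odd (∑ n ∈ T₁, n.factorization p) ↔ Odd (∑ n ∈ T₂, n.factorization p) := by
        by_cases hpy : p ≤ ⌊y⌋₊
        · have := Finset.ext_iff.1 heq p
          simpa [odds, hpy, hp.one_le] using this
        · have hz : ∀ T ⊆ B, ∑ n ∈ T, n.factorization p = 0 := fun T hT =>
            Finset.sum_eq_zero fun n hn => Nat.factorization_eq_zero_of_not_dvd fun hd =>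
              hpy ((Nat.le_floor_iff hy).2 ((hB n (hT hn)).2.2 p hp hd))
          rw [hz _ h₁, hz _ h₂]
      have hs : ∑ n ∈ symmDiff T₁ T₂, n.factorization p =
          ∑ n ∈ T₁ \ T₂, n.factorization p + ∑ n ∈ T₂ \ T₁, n.factorization p :=
        Finset.sum_union disjoint_sdiff_sdiff
      have e1 := Finset.sum_inter_add_sum_sdiff T₁ T₂ fun n => n.factorization p
      have e2 := Finset.sum_inter_add_sum_sdiff T₂ T₁ fun n => n.factorization p
      rw [Finset.inter_comm] at e2
      rw [hs]
      rw [← e1, ← e2] at hpar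
      grind
    -- The least element is completed to a square by the others, which are larger and at most E: a
    -- contradiction.
    set m := (symmDiff T₁ T₂).min' hDne
    have hm : m ∈ symmDiff T₁ T₂ := Finset.min'_mem _ _
    refine hsq m (hDB hm) ((symmDiff T₁ T₂).erase m) (fun n hn => ?_) ?_
    · rw [Finset.mem_erase] at hn
      rw [Finset.mem_Ioc]
      exact ⟨lt_of_le_of_ne (Finset.min'_le _ _ hn.2) (Ne.symm hn.1), (hB n (hDB hn.2)).2.1⟩
    · rwa [Finset.mul_prod_erase _ (fun n => n) hm]
  have hmaps : Set.MapsTo odds (B.powerset : Set (Finset ℕ))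
      ((Finset.Icc 1 ⌊y⌋₊).powerset : Set (Finset ℕ)) := fun T _ => by
    rw [Finset.mem_coe, Finset.mem_powerset]
    exact Finset.filter_subset _ _
  have hcard := Finset.card_le_card_of_injOn odds hmaps hinj
  rw [Finset.card_powerset, Finset.card_powerset, Nat.card_Icc, Nat.add_sub_cancel] at hcard
  exact (Nat.pow_le_pow_iff_right (by norm_num)).1 hcard

theorem smoothCount_rpow_le_squareShift {b c c' x : ℝ} (hb : 0 < b) (hbc : b < c)
    (hc1 : c ≤ 1) (hx : 1 ≤ x) :
    (smoothCount x (x ^ c') : ℝ) ≤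
      countUpTo (fun n => (squareShift n : ℝ) ≤ (n : ℝ) ^ c) x + x ^ (b / c) +
        3 * x ^ (1 - b + c') := by
  classical
  have hc0 : 0 < c := hb.trans hbc
  have hx0 : 0 < x := by linarith
  set H := ⌊x ^ b⌋₊ with hH
  have hxb : 1 ≤ x ^ b := Real.one_le_rpow hx hb.le
  have hH1 : 1 ≤ H := (Nat.one_le_floor_iff _).2 hxb
  have hHle : (H : ℝ) ≤ x ^ b := Nat.floor_le (by positivity)
  -- `((n - 1) / H + 1) * H` is the right end of the block (jH, (j+1)H] containing n.
  set Bad : ℕ → Prop := fun n => IsSmooth (x ^ c') n ∧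
    ∀ S ⊆ Finset.Ioc n (((n - 1) / H + 1) * H), ¬ IsSquare (n * ∏ m ∈ S, m) with hBad
  have hblock : ∀ n : ℕ, 1 ≤ n → n ≤ ((n - 1) / H + 1) * H ∧ ((n - 1) / H + 1) * H < n + H := by
    intro n hn
    have h1 := Nat.div_add_mod (n - 1) H
    have h2 := Nat.mod_lt (n - 1) hH1
    rw [mul_comm] at h1
    rw [add_mul]
    omega
  have h1 : smoothCount x (x ^ c') ≤
      countUpTo (fun n => (squareShift n : ℝ) ≤ (n : ℝ) ^ c ∨ (n : ℝ) ≤ x ^ (b / c)) x +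
      countUpTo Bad x := by
    refine countUpTo_le_add fun n hn _ hs => ?_
    by_cases hbad : Bad n
    · exact Or.inr hbad
    left
    rcases le_or_gt (n : ℝ) (x ^ (b / c)) with h1 | h1
    · exact Or.inr h1
    left
    obtain ⟨S, hS, hsq⟩ : ∃ S ⊆ Finset.Ioc n (((n - 1) / H + 1) * H),
        IsSquare (n * ∏ m ∈ S, m) := by
      by_contra hcon
      push Not at hcon
      exact hbad ⟨hs, hcon⟩
    obtain ⟨h2, h3⟩ := hblock n hn
    have h4 : squareShift n ≤ H := (squareShift_le h2 hS hsq).trans (by omega)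
    calc (squareShift n : ℝ) ≤ H := by exact_mod_cast h4
      _ ≤ x ^ b := hHle
      _ = (x ^ (b / c)) ^ c := by rw [← Real.rpow_mul hx0.le, div_mul_cancel₀ _ hc0.ne']
      _ ≤ _ := by gcongr
  have h2 : countUpTo (fun n => (squareShift n : ℝ) ≤ (n : ℝ) ^ c ∨ (n : ℝ) ≤ x ^ (b / c)) x ≤
      countUpTo (fun n => (squareShift n : ℝ) ≤ (n : ℝ) ^ c) x +
      countUpTo (fun n => (n : ℝ) ≤ x ^ (b / c)) x := countUpTo_le_add fun _ _ _ h => h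
  have h3 : (countUpTo (fun n => (n : ℝ) ≤ x ^ (b / c)) x : ℝ) ≤ x ^ (b / c) :=
    countUpTo_le_of_bounded (by positivity) fun _ _ _ h => h
  have h4 : countUpTo Bad x ≤ ⌊x ^ c'⌋₊ * (Finset.range (⌊x⌋₊ / H + 1)).card := by
    refine Finset.card_le_mul_card_image_of_maps_to (f := fun n => (n - 1) / H) ?_ _ ?_
    · intro n hn
      simp only [Finset.mem_filter, Finset.mem_Icc] at hn
      rw [Finset.mem_range, Nat.lt_succ_iff]
      exact Nat.div_le_div_right (by omega)
    · intro j _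
      refine card_le_of_forall_not_isSquare (E := (j + 1) * H) (by positivity) ?_ ?_
      · intro n hn
        simp only [Finset.mem_filter, Finset.mem_Icc] at hn
        obtain ⟨⟨⟨hn1, -⟩, hs, -⟩, rfl⟩ := hn
        exact ⟨by omega, (hblock n hn1).1, hs⟩
      · intro n hn
        simp only [Finset.mem_filter, Finset.mem_Icc] at hn
        obtain ⟨⟨-, -, hs⟩, rfl⟩ := hn
        exact hs
  have h5 : (countUpTo Bad x : ℝ) ≤ 3 * x ^ (1 - b + c') := by
    -- The 3 is 2 + 1: a factor 2 from H ≥ x^b / 2, and 1 ≤ x^(1-b), valid as b < c ≤ 1, for the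
    -- extra block.
    have h6 : ((⌊x⌋₊ / H : ℕ) : ℝ) + 1 ≤ 3 * x ^ (1 - b) := by
      have h7 : x ^ b ≤ 2 * H := by
        have := Nat.lt_floor_add_one (x ^ b)
        have h8 : (1 : ℝ) ≤ H := by exact_mod_cast hH1
        linarith
      have h8 : ((⌊x⌋₊ / H : ℕ) : ℝ) ≤ x / H :=
        Nat.cast_div_le.trans (by gcongr; exact Nat.floor_le hx0.le)
      have h9 : x / H ≤ 2 * x ^ (1 - b) := by
        rw [Real.rpow_sub hx0, Real.rpow_one, ← mul_div_assoc,
          div_le_div_iff₀ (by exact_mod_cast hH1) (by positivity)]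
        nlinarith
      have h10 : 1 ≤ x ^ (1 - b) := Real.one_le_rpow hx (by linarith)
      linarith
    rw [Finset.card_range] at h4
    calc (countUpTo Bad x : ℝ) ≤ (⌊x ^ c'⌋₊ : ℝ) * ((⌊x⌋₊ / H : ℕ) + 1) := by exact_mod_cast h4
      _ ≤ x ^ c' * (3 * x ^ (1 - b)) := by
          gcongr
          exact Nat.floor_le (by positivity)
      _ = _ := by
          rw [Real.rpow_add hx0]
          ring
  have h11 : (smoothCount x (x ^ c') : ℝ) ≤
      (countUpTo (fun n => (squareShift n : ℝ) ≤ (n : ℝ) ^ c) x +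
      countUpTo (fun n => (n : ℝ) ≤ x ^ (b / c)) x) + countUpTo Bad x := by
    exact_mod_cast h1.trans (Nat.add_le_add_right h2 _)
  linarith

/-! ### Upper bound for the count of t_n ≤ n^c -/

/-- The square is divisible by p², so p divides some chosen m > n, and then p divides m - n ≤ t_n.
-/
theorem le_squareShift_of_sq_not_dvd {n p : ℕ} (hp : p.Prime) (hd : p ∣ n)
    (hsq : ¬ p ^ 2 ∣ n) : p ≤ squareShift n := by
  obtain ⟨S, hS, hprod⟩ := Nat.sInf_mem (squareShift_set_nonempty n)
  change S ⊆ Finset.Ioc n (n + squareShift n) at hS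
  have hdvd : p ^ 2 ∣ n * ∏ m ∈ S, m := by
    obtain ⟨r, hr⟩ := hprod
    have h1 : p ∣ r * r := hr ▸ hd.mul_right _
    have h2 : p ∣ r := by rcases hp.dvd_mul.1 h1 with h | h <;> exact h
    rw [hr, pow_two]
    exact mul_dvd_mul h2 h2
  have h3 : p ∣ ∏ m ∈ S, m := by
    by_contra h
    exact hsq (((hp.coprime_iff_not_dvd.2 h).pow_left 2).dvd_of_dvd_mul_right hdvd)
  obtain ⟨m, hm, hpm⟩ := (hp.prime.dvd_finsetProd_iff _).1 h3
  have hm' := Finset.mem_Ioc.1 (hS hm)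
  have h4 : p ∣ m - n := Nat.dvd_sub hpm hd
  have h5 := Nat.le_of_dvd (by omega) h4
  omega

/-- Union bound: the sum of x/d² over d > D is at most 2x/(D + 1). -/
theorem exists_countUpTo_sq_dvd_le {ε : ℝ} (hε : 0 < ε) : ∃ D : ℕ, ∀ x : ℝ, 0 ≤ x →
    (countUpTo (fun n => ∃ d, D < d ∧ d ^ 2 ∣ n) x : ℝ) ≤ ε * x := by
  classical
  obtain ⟨D, hD⟩ := exists_nat_gt (2 / ε)
  refine ⟨D, fun x hx => ?_⟩
  have h1 : countUpTo (fun n => ∃ d, D < d ∧ d ^ 2 ∣ n) x ≤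
      ∑ d ∈ Finset.Ioo D (⌊x⌋₊ + 1), ⌊x⌋₊ / d ^ 2 := by
    refine (Finset.card_le_card (t := (Finset.Ioo D (⌊x⌋₊ + 1)).biUnion fun d =>
      (Finset.Ioc 0 ⌊x⌋₊).filter fun n => d ^ 2 ∣ n) fun n hn => ?_).trans
      (Finset.card_biUnion_le.trans (Finset.sum_le_sum fun d _ => ?_))
    · rw [Finset.mem_filter, Finset.mem_Icc] at hn
      obtain ⟨⟨hn1, hnx⟩, d, hDd, hd⟩ := hn
      have h2 := Nat.le_of_dvd hn1 hd
      have h3 : d ≤ d ^ 2 := Nat.le_self_pow two_ne_zero d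
      simp only [Finset.mem_biUnion, Finset.mem_Ioo, Finset.mem_filter, Finset.mem_Ioc]
      exact ⟨d, ⟨hDd, by omega⟩, ⟨hn1, hnx⟩, hd⟩
    · rw [Nat.Ioc_filter_dvd_card_eq_div]
  calc (countUpTo (fun n => ∃ d, D < d ∧ d ^ 2 ∣ n) x : ℝ)
      ≤ ∑ d ∈ Finset.Ioo D (⌊x⌋₊ + 1), ((⌊x⌋₊ / d ^ 2 : ℕ) : ℝ) := by exact_mod_cast h1
    _ ≤ ∑ d ∈ Finset.Ioo D (⌊x⌋₊ + 1), x * ((d : ℝ) ^ 2)⁻¹ := by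
        refine Finset.sum_le_sum fun d _ => Nat.cast_div_le.trans ?_
        push_cast
        rw [div_eq_mul_inv]
        gcongr
        exact Nat.floor_le hx
    _ = x * ∑ d ∈ Finset.Ioo D (⌊x⌋₊ + 1), ((d : ℝ) ^ 2)⁻¹ := by rw [Finset.mul_sum]
    _ ≤ x * (2 / ((D : ℝ) + 1)) := by
        gcongr
        exact sum_Ioo_inv_sq_le _ _
    _ ≤ x * ε := by
        gcongr
        rw [div_lt_iff₀ hε] at hD
        rw [div_le_iff₀ (by positivity)]
        linarith
    _ = ε * x := mul_comm _ _

/-- If t_n ≤ n^c < P⁺(n), then P⁺(n)² divides n, and P⁺(n) > D once n ≥ D^(1/c). The constant `b`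
absorbs smaller n, its summand 1 ensuring n ≥ 2. -/
theorem exists_countUpTo_squareShift_le {c ε : ℝ} (hc : 0 < c) (hε : 0 < ε) :
    ∃ b : ℝ, ∀ x : ℝ, 0 ≤ x →
      (countUpTo (fun n => (squareShift n : ℝ) ≤ (n : ℝ) ^ c) x : ℝ) ≤
        countUpTo (fun n => (largestPrimeFactor n : ℝ) ≤ (n : ℝ) ^ c) x + ε * x + b := by
  obtain ⟨D, hD⟩ := exists_countUpTo_sq_dvd_le hε
  refine ⟨1 + (D : ℝ) ^ (1 / c), fun x hx => ?_⟩
  have h1 : countUpTo (fun n => (squareShift n : ℝ) ≤ (n : ℝ) ^ c) x ≤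
      countUpTo (fun n => (largestPrimeFactor n : ℝ) ≤ (n : ℝ) ^ c ∨
        ∃ d, D < d ∧ d ^ 2 ∣ n) x +
      countUpTo (fun n => (n : ℝ) ≤ 1 + (D : ℝ) ^ (1 / c)) x := by
    refine countUpTo_le_add fun n hn _ hs => ?_
    rcases le_or_gt (n : ℝ) (1 + (D : ℝ) ^ (1 / c)) with h | h
    · exact Or.inr h
    left
    have hpos : 0 ≤ (D : ℝ) ^ (1 / c) := by positivity
    have hn2 : 2 ≤ n := by
      have : (1 : ℝ) < n := by linarith
      exact_mod_cast this
    rcases le_or_gt (largestPrimeFactor n : ℝ) ((n : ℝ) ^ c) with h2 | h2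
    · exact Or.inl h2
    refine Or.inr ⟨largestPrimeFactor n, ?_, ?_⟩
    · have h3 : (D : ℝ) ≤ (n : ℝ) ^ c := by
        calc (D : ℝ) = ((D : ℝ) ^ (1 / c)) ^ c := by
              rw [← Real.rpow_mul (by positivity), one_div_mul_cancel hc.ne', Real.rpow_one]
          _ ≤ (n : ℝ) ^ c := by
              gcongr
              linarith
      exact_mod_cast h3.trans_lt h2
    · by_contra h3
      have h4 : (largestPrimeFactor n : ℝ) ≤ squareShift n := by
        exact_mod_cast le_squareShift_of_sq_not_dvd (largestPrimeFactor_prime hn2)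
          (largestPrimeFactor_dvd hn2) h3
      linarith
  have h2 : countUpTo (fun n => (largestPrimeFactor n : ℝ) ≤ (n : ℝ) ^ c ∨
      ∃ d, D < d ∧ d ^ 2 ∣ n) x ≤
      countUpTo (fun n => (largestPrimeFactor n : ℝ) ≤ (n : ℝ) ^ c) x +
      countUpTo (fun n => ∃ d, D < d ∧ d ^ 2 ∣ n) x := countUpTo_le_add fun _ _ _ h => h
  have h3 : (countUpTo (fun n => (n : ℝ) ≤ 1 + (D : ℝ) ^ (1 / c)) x : ℝ) ≤
      1 + (D : ℝ) ^ (1 / c) :=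
    countUpTo_le_of_bounded (by positivity) fun _ _ _ h => h
  have h4 : (countUpTo (fun n => (squareShift n : ℝ) ≤ (n : ℝ) ^ c) x : ℝ) ≤
      (countUpTo (fun n => (largestPrimeFactor n : ℝ) ≤ (n : ℝ) ^ c) x +
      countUpTo (fun n => ∃ d, D < d ∧ d ^ 2 ∣ n) x) +
      countUpTo (fun n => (n : ℝ) ≤ 1 + (D : ℝ) ^ (1 / c)) x := by
    exact_mod_cast h1.trans (Nat.add_le_add_right h2 _)
  linarith [hD x hx]

/-! ### The density of t_n ≤ n^c and its consequences -/

theorem tendsto_countUpTo_squareShift {c : ℝ} (hc : 0 < c) (hc1 : c ≤ 1) :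
    Tendsto (fun x : ℝ => (countUpTo (fun n => (squareShift n : ℝ) ≤ (n : ℝ) ^ c) x : ℝ) / x)
      atTop (𝓝 (dickman (1 / c))) := by
  refine tendsto_order.2 ⟨fun a ha => eventually_lt_of_smoothCount_le hc (fun c' h0 h1 => ?_) ha,
    fun a ha => ?_⟩
  -- c' < b < c makes both error exponents, b/c - 1 and c' - b, negative.
  · obtain ⟨b, hb1, hb2⟩ := exists_between h1
    have hb0 : 0 < b := h0.trans hb1
    refine ⟨fun x => x ^ (b / c - 1) + 3 * x ^ (c' - b), ?_, ?_⟩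
    · have e1 : Tendsto (fun x : ℝ => x ^ (b / c - 1)) atTop (𝓝 0) :=
        tendsto_rpow_atTop_zero (by rw [sub_neg]; exact (div_lt_one hc).2 hb2)
      have e2 : Tendsto (fun x : ℝ => x ^ (c' - b)) atTop (𝓝 0) :=
        tendsto_rpow_atTop_zero (by linarith)
      simpa using e1.add (e2.const_mul 3)
    · filter_upwards [eventually_ge_atTop 1] with x hx
      have hx0 : 0 < x := by linarith
      have h2 := smoothCount_rpow_le_squareShift (c' := c') hb0 hb2 hc1 hx
      have h3 : x ^ (b / c - 1) = x ^ (b / c) / x := by rw [Real.rpow_sub hx0, Real.rpow_one]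
      have h4 : x ^ (c' - b) = x ^ (1 - b + c') / x := by
        rw [← Real.rpow_sub_one hx0.ne']
        congr 1
        ring
      rw [h3, h4, ← mul_div_assoc, ← add_div, ← add_div, ← add_assoc]
      gcongr
  · obtain ⟨a', ha1, ha2⟩ := exists_between ha
    -- The gap a - a' is the density allowed to the integers with a large square divisor.
    obtain ⟨b, hb⟩ := exists_countUpTo_squareShift_le hc (sub_pos.2 ha2)
    have ht := (tendsto_countUpTo_largestPrimeFactor hc).add
      ((tendsto_const_nhds (x := b)).div_atTop tendsto_id)
    rw [add_zero] at ht
    filter_upwards [ht.eventually (gt_mem_nhds ha1), eventually_gt_atTop 0] with x h1 hx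
    have h2 := hb x hx.le
    rw [id, ← add_div, div_lt_iff₀ hx] at h1
    rw [div_lt_iff₀ hx]
    linarith

theorem exists_le_countUpTo_squareShift {c : ℝ} (hc : 0 < c) : ∃ δ : ℝ, 0 < δ ∧
    ∀ᶠ x : ℝ in atTop,
      δ * x ≤ (countUpTo (fun n => (squareShift n : ℝ) ≤ (n : ℝ) ^ c) x : ℝ) := by
  have hc' : 0 < min c 1 := lt_min hc one_pos
  have hpos := dickman_pos (show 0 < 1 / min c 1 by positivity)
  refine ⟨dickman (1 / min c 1) / 2, half_pos hpos, ?_⟩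
  filter_upwards [(tendsto_countUpTo_squareShift hc' (min_le_right _ _)).eventually
    (lt_mem_nhds (half_lt_self hpos)), eventually_gt_atTop 0] with x h1 hx
  rw [lt_div_iff₀ hx] at h1
  refine h1.le.trans (Nat.cast_le.2 (countUpTo_mono fun n hn _ h => h.trans ?_))
  exact Real.rpow_le_rpow_of_exponent_le (by exact_mod_cast hn) (min_le_left _ _)

theorem countUpTo_isSquare_le {x : ℝ} (hx : 0 ≤ x) : (countUpTo IsSquare x : ℝ) ≤ √x := by
  classical
  have h : countUpTo IsSquare x ≤ (Finset.Icc 1 ⌊√x⌋₊).card := by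
    refine Finset.card_le_card_of_injOn Nat.sqrt (fun n hn => ?_) (fun m hm n hn h => ?_)
    · simp only [Finset.mem_coe, Finset.mem_filter, Finset.mem_Icc] at hn
      obtain ⟨⟨hn1, hnx⟩, r, rfl⟩ := hn
      have h1 := (Nat.le_floor_iff hx).1 hnx
      rw [Nat.sqrt_eq, Finset.mem_coe, Finset.mem_Icc]
      refine ⟨Nat.pos_of_mul_pos_left hn1, Nat.le_floor (Real.le_sqrt_of_sq_le ?_)⟩
      push_cast at h1
      linarith
    · simp only [Finset.mem_coe, Finset.mem_filter] at hm hn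
      obtain ⟨-, r, rfl⟩ := hm
      obtain ⟨-, s, rfl⟩ := hn
      rw [Nat.sqrt_eq, Nat.sqrt_eq] at h
      rw [h]
  rw [Nat.card_Icc, Nat.add_sub_cancel] at h
  exact (Nat.cast_le.2 h).trans (Nat.floor_le (by positivity))

/-- Otherwise t_n ≤ n^c would hold only for squares and for n < N, at most √x + N integers up to x,
fewer than δx for large x. -/
theorem not_eventually_lt_squareShift {c : ℝ} (hc : 0 < c) :
    ¬ ∀ᶠ n : ℕ in atTop, ¬ IsSquare n → (n : ℝ) ^ c < (squareShift n : ℝ) := by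
  intro h
  obtain ⟨N, hN⟩ := eventually_atTop.1 h
  obtain ⟨δ, hδ, hev⟩ := exists_le_countUpTo_squareShift hc
  have ht : Tendsto (fun x : ℝ => x ^ (-(1 / 2) : ℝ) + N / x) atTop (𝓝 (0 + 0)) :=
    (tendsto_rpow_neg_atTop (by norm_num)).add (tendsto_const_nhds.div_atTop tendsto_id)
  rw [add_zero] at ht
  obtain ⟨x, ⟨h1, h2⟩, hx⟩ :=
    ((hev.and (ht.eventually (gt_mem_nhds hδ))).and (eventually_gt_atTop 0)).exists
  have h3 : countUpTo (fun n => (squareShift n : ℝ) ≤ (n : ℝ) ^ c) x ≤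
      countUpTo IsSquare x + countUpTo (fun n => (n : ℝ) ≤ N) x := by
    refine countUpTo_le_add fun n _ _ hs => ?_
    by_contra hcon
    rw [not_or, not_le, Nat.cast_lt] at hcon
    exact absurd hs (not_le.2 (hN n hcon.2.le hcon.1))
  have h4 : (countUpTo (fun n => (n : ℝ) ≤ N) x : ℝ) ≤ N :=
    countUpTo_le_of_bounded (by positivity) fun _ _ _ h => h
  have h5 : (countUpTo (fun n => (squareShift n : ℝ) ≤ (n : ℝ) ^ c) x : ℝ) ≤
      countUpTo IsSquare x + countUpTo (fun n => (n : ℝ) ≤ N) x := by exact_mod_cast h3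
  have h6 := countUpTo_isSquare_le hx.le
  have h7 : (x ^ (-(1 / 2) : ℝ) + N / x) * x = √x + N := by
    rw [add_mul, div_mul_cancel₀ _ hx.ne', ← Real.rpow_add_one hx.ne', Real.sqrt_eq_rpow]
    norm_num
  have h8 := mul_lt_mul_of_pos_right h2 hx
  linarith

theorem theorem1p1 :
    (∀ c : ℝ, 0 < c → c ≤ 1 →
      Tendsto (fun x : ℝ =>
          (countUpTo (fun n => (squareShift n : ℝ) ≤ (n : ℝ) ^ c) x : ℝ) / x)
        atTop (𝓝 (dickman (1 / c))) ∧
      Tendsto (fun x : ℝ =>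
          (countUpTo (fun n => (largestPrimeFactor n : ℝ) ≤ (n : ℝ) ^ c) x : ℝ) / x)
        atTop (𝓝 (dickman (1 / c))) ∧
      0 < dickman (1 / c)) ∧
    (∀ c : ℝ, 0 < c → ∃ δ : ℝ, 0 < δ ∧ ∀ᶠ x : ℝ in atTop,
      δ * x ≤ (countUpTo (fun n => (squareShift n : ℝ) ≤ (n : ℝ) ^ c) x : ℝ)) ∧
    ¬ ∃ c : ℝ, 0 < c ∧ ∀ᶠ n : ℕ in atTop, ¬ IsSquare n → (n : ℝ) ^ c < (squareShift n : ℝ) :=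
  ⟨fun _ h0 h1 => ⟨tendsto_countUpTo_squareShift h0 h1, tendsto_countUpTo_largestPrimeFactor h0,
      dickman_pos (one_div_pos.2 h0)⟩,
    fun _ hc => exists_le_countUpTo_squareShift hc,
    fun ⟨_, hc, h⟩ => not_eventually_lt_squareShift hc h⟩
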